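/- All groups are finite. Let $\pi$ be a set of primes and let $\pi'$ be the complementary set of primes. A positive integer is a $\pi$-number if all its prime divisors lie in $\pi$; a group is a $\pi$-group if its order is a $\pi$-number; a Hall $\pi$-subgroup of $G$ is a subgroup $H$ such that $|H|$ is a $\pi$-number and $|G:H|$ is a $\pi'$-number. A group is $\pi$-solvable if it has a normal series each of whose factors is a $\pi'$-group or a solvable $\pi$-group. For a subgroup $M$ of $G$, $\mathrm{Core}_G M=\bigcap_{g\in G} g^{-1}Mg$; $F(X)$ denotes the Fitting subgroup of $X$ (its largest nilpotent normal subgroup). Theorem 3. Let $G$ be a finite $\pi$-solvable group containing a nilpotent Hall $\pi$-subgroup. Let $M$ be a non-normal maximal subgroup of $G$ whose index $|G:M|$ is a $\pi$-number. Then: 1) if $F(M/\mathrm{Core}_G M)\neq 1$ and $q$ is a prime divisor of $|F(M/\mathrm{Core}_G M)|$, then $G$ has a Sylow $q$-subgroup $Q$ such that $N_G(Q)\subseteq M$; 2) if $F(M/\mathrm{Core}_G M)=1$, then $N_G(K)\subseteq M$ for some Hall $\pi'$-subgroup $K$ of $G$. -/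

import Mathlib

/-- `m` is a `π`-number: every prime divisor of `m` lies in the set of primes `π`.
The complementary set of primes `π'` is the set complement `πᶜ`. -/
def IsPiNumber (π : Set Nat.Primes) (m : ℕ) : Prop :=
  ∀ p : Nat.Primes, (p : ℕ) ∣ m → p ∈ π

/-- `H` is a Hall `π`-subgroup of the finite group `G`: the order `|H|` is a `π`-number and
the index `|G : H|` is a `π'`-number. -/
def IsHallSubgroup {G : Type*} [Group G] (π : Set Nat.Primes) (H : Subgroup G) : Prop :=
  IsPiNumber π (Nat.card H) ∧ IsPiNumber πᶜ H.index

/-- The finite group `G` is `π`-solvable: it has a normal series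
`1 = H 0 ≤ H 1 ≤ ⋯ ≤ H n = G` each of whose factors `H (i + 1) / H i` is a `π'`-group or a
solvable `π`-group. -/
def IsPiSolvable (π : Set Nat.Primes) (G : Type*) [Group G] : Prop :=
  ∃ (n : ℕ) (H : ℕ → Subgroup G) (_ : ∀ i, (H i).Normal),
    H 0 = ⊥ ∧ H n = ⊤ ∧
    ∀ i < n, H i ≤ H (i + 1) ∧
      (IsPiNumber πᶜ (Nat.card (H (i + 1) ⧸ (H i).subgroupOf (H (i + 1)))) ∨
        (IsPiNumber π (Nat.card (H (i + 1) ⧸ (H i).subgroupOf (H (i + 1)))) ∧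
          Group.IsSolvable (H (i + 1) ⧸ (H i).subgroupOf (H (i + 1)))))

/-- The Fitting subgroup `F(G)`: the subgroup generated by all nilpotent normal subgroups of `G`
(for finite `G`, the largest nilpotent normal subgroup). -/
def fittingSubgroup (G : Type*) [Group G] : Subgroup G :=
  sSup {N : Subgroup G | N.Normal ∧ Group.IsNilpotent N}

/-! Modulo its core, `M` becomes a core-free maximal subgroup. A normal `π'`-subgroup cannot
supplement it, its index being a nontrivial `π`-number, so `π`-solvability yields an abelian normal
`A ≠ 1`, which complements `M`. If `1 ≠ R` is normal in `M`, then `C_A(R)` is normal in `AM`, hence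
trivial by minimality of `A` and `C_M(A) = 1`. So any `X` with `R ≤ X ≤ M` has its normalizer inside
`M` (`normalizer_le_of_le`). A Sylow or Hall subgroup of `M` whose index is coprime to `|R|` covers
`R`. In 1) `R` is a `q`-group and `q ∤ |A| = |G : M|`, so Sylow `q`-subgroups of `M` are Sylow in
`G`. In 2) triviality of the Fitting subgroup forces a normal `π'`-subgroup `R`, and Hall
`π'`-subgroups of `M` are Hall in `G`. -/

section PiNumbers

variable {π : Set Nat.Primes} {m n : ℕ}

theorem IsPiNumber.of_dvd (h : IsPiNumber π n) (hmn : m ∣ n) : IsPiNumber π m :=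
  fun p hp ↦ h p (hp.trans hmn)

theorem IsPiNumber.mul (hm : IsPiNumber π m) (hn : IsPiNumber π n) : IsPiNumber π (m * n) :=
  fun p hp ↦ (p.2.dvd_mul.mp hp).elim (hm p) (hn p)

theorem isPiNumber_one : IsPiNumber π 1 :=
  fun p hp ↦ (p.2.one_lt.ne' (Nat.dvd_one.mp hp)).elim

theorem IsPiNumber.coprime (hm : IsPiNumber π m) (hn : IsPiNumber πᶜ n) : m.Coprime n :=
  Nat.coprime_of_dvd fun p hp h₁ h₂ ↦ hn ⟨p, hp⟩ h₂ (hm ⟨p, hp⟩ h₁)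

theorem IsPiNumber.eq_one (hm : IsPiNumber π m) (hm' : IsPiNumber πᶜ m) : m = 1 :=
  (Nat.coprime_self m).mp (hm.coprime hm')

end PiNumbers

/-! ### Indices and normal subgroups. -/

namespace Subgroup

variable {G : Type*} [Group G]

/-- Compute `|KR : K ∩ R|` through `K` and through `R`, then cancel `|K : K ∩ R| = |KR : R|`. -/
theorem relIndex_sup_eq_of_normal [Finite G] (K R : Subgroup G) [R.Normal] :
    K.relIndex (K ⊔ R) = K.relIndex R := by
  have h₁ := relIndex_mul_relIndex (K ⊓ R) K (K ⊔ R) inf_le_left le_sup_left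
  have h₂ := relIndex_mul_relIndex (K ⊓ R) R (K ⊔ R) inf_le_right le_sup_right
  rw [inf_relIndex_left] at h₁
  rw [inf_relIndex_right, relIndex_sup_right] at h₂
  have h₀ : R.relIndex K ≠ 0 := index_ne_zero_of_finite
  exact Nat.eq_of_mul_eq_mul_left (Nat.pos_of_ne_zero h₀) (by rw [h₁, ← h₂, mul_comm])

theorem relIndex_dvd_index_of_normal_right [Finite G] (K R : Subgroup G) [R.Normal] :
    K.relIndex R ∣ K.index := by
  rw [← relIndex_sup_eq_of_normal]
  exact relIndex_dvd_index_of_le le_sup_left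

theorem index_eq_relIndex_of_sup_eq_top [Finite G] {K R : Subgroup G} [R.Normal]
    (h : K ⊔ R = ⊤) : K.index = K.relIndex R := by
  rw [← relIndex_sup_eq_of_normal, h, relIndex_top_right]

/-- A normal subgroup whose order is coprime to the index of `K` is contained in `K`. -/
theorem le_of_coprime_card_index [Finite G] {K R : Subgroup G} [R.Normal]
    (h : (Nat.card R).Coprime K.index) : R ≤ K := by
  rw [← relIndex_eq_one]
  exact Nat.eq_one_of_dvd_coprimes h (relIndex_dvd_card K R) (relIndex_dvd_index_of_normal_right K R)

theorem normal_of_le_normalizer_of_sup_eq_top {A M X : Subgroup G} (h : A ⊔ M = ⊤)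
    (hA : A ≤ normalizer (X : Set G)) (hM : M ≤ normalizer (X : Set G)) : X.Normal :=
  normalizer_eq_top_iff.mp (top_le_iff.mp (h ▸ sup_le hA hM))

/-- A nontrivial normal solvable subgroup contains a nontrivial abelian subgroup which is normal
in the whole group. -/
theorem exists_abelian_normal_of_isSolvable [Finite G] (L : Subgroup G) (hL : L.Normal)
    (hne : L ≠ ⊥) (hs : Group.IsSolvable L) :
    ∃ A : Subgroup G, A.Normal ∧ A ≠ ⊥ ∧ A ≤ L ∧ ∀ a ∈ A, ∀ b ∈ A, a * b = b * a := by
  obtain ⟨A, hAL, hA⟩ :=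
    (Set.toFinite {X : Subgroup G | X.Normal ∧ X ≠ ⊥ ∧ X ≤ L}).exists_le_minimal
      (a := L) ⟨hL, hne, le_rfl⟩
  obtain ⟨hAn, hAne, -⟩ := hA.1
  have hsA : Group.IsSolvable A :=
    Group.isSolvable_of_isSolvable_injective (inclusion_injective hAL)
  refine ⟨A, hAn, hAne, hAL, ?_⟩
  -- By minimality a nontrivial derived subgroup would equal `A`, contradicting solvability.
  have hAb : ⁅A, A⁆ = ⊥ := by
    by_contra hb
    have hle : ⁅A, A⁆ ≤ A := commutator_le_left A A
    have hge : A ≤ ⁅A, A⁆ :=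
      hA.2 ⟨commutator_normal A A, hb, hle.trans hAL⟩ hle
    have hcA : ⁅(⊤ : Subgroup A), (⊤ : Subgroup A)⁆ < ⊤ := by
      have : Nontrivial A := (nontrivial_iff_ne_bot A).mpr hAne
      exact Group.IsSolvable.commutator_lt_top_of_nontrivial A
    have hm : map A.subtype ⁅(⊤ : Subgroup A), (⊤ : Subgroup A)⁆ = map A.subtype ⊤ := by
      rw [map_commutator, ← MonoidHom.range_eq_map, range_subtype, le_antisymm hle hge]
    exact hcA.ne (map_injective A.subtype_injective hm)
  intro a ha b hb
  rw [commutator_eq_bot_iff_le_centralizer] at hAb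
  exact (mem_centralizer_iff.mp (hAb ha) b hb).symm

end Subgroup

/-! ### Core-free maximal subgroups and abelian normal subgroups. -/

section Primitive

open Subgroup

variable {G : Type*} [Group G] {M A R X : Subgroup G}

theorem eq_bot_of_normal_of_le (hcore : M.normalCore = ⊥) (hX : X.Normal) (hXM : X ≤ M) :
    X = ⊥ :=
  le_bot_iff.mp (hcore ▸ normal_le_normalCore.mpr hXM)

theorem sup_eq_top_of_normal (hM : IsCoatom M) (hcore : M.normalCore = ⊥) (hX : X.Normal)
    (hne : X ≠ ⊥) : X ⊔ M = ⊤ := by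
  refine hM.2 _ (lt_of_le_of_ne le_sup_right fun h ↦ hne ?_)
  exact eq_bot_of_normal_of_le hcore hX (h ▸ le_sup_left)

theorem le_normalizer_of_commute {B X : Subgroup G} (h : ∀ b ∈ B, ∀ x ∈ X, b * x = x * b) :
    B ≤ normalizer (X : Set G) :=
  le_normalizer_iff.mpr fun b hb x hx ↦ by rwa [h b hb x hx, mul_inv_cancel_right]

variable (hM : IsCoatom M) (hcore : M.normalCore = ⊥) (hA : A.Normal) (hne : A ≠ ⊥)
  (hcomm : ∀ a ∈ A, ∀ b ∈ A, a * b = b * a)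

include hM hcore hA hne hcomm

/-- The intersection is centralized by `A` and normalized by `M`, hence normal in `G = AM`, and it
lies in `M`, which is core-free. -/
theorem inf_eq_bot_of_abelian_normal : A ⊓ M = ⊥ := by
  refine eq_bot_of_normal_of_le hcore ?_ inf_le_right
  refine normal_of_le_normalizer_of_sup_eq_top (sup_eq_top_of_normal hM hcore hA hne)
    (le_normalizer_of_commute fun a ha x hx ↦ hcomm a ha x hx.1) ?_
  exact le_normalizer_iff.mpr fun m hm x hx ↦
    ⟨hA.conj_mem x hx.1 m, M.mul_mem (M.mul_mem hm hx.2) (M.inv_mem hm)⟩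

/-- Minimality of `A` is automatic: `G = BM` gives `A = B(A ∩ M)`, and `A ∩ M = 1`. -/
theorem eq_of_normal_of_le_of_ne_bot {B : Subgroup G} (hB : B.Normal) (hBA : B ≤ A)
    (hBne : B ≠ ⊥) : B = A := by
  refine le_antisymm hBA fun a ha ↦ ?_
  have h : a ∈ B ⊔ M := sup_eq_top_of_normal hM hcore hB hBne ▸ mem_top a
  obtain ⟨b, hb, m, hm, rfl⟩ := mem_sup_of_normal_left.mp h
  have hmA : m ∈ A ⊓ M := ⟨(A.mul_mem_cancel_left (hBA hb)).mp ha, hm⟩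
  rw [inf_eq_bot_of_abelian_normal hM hcore hA hne hcomm, mem_bot] at hmA
  rwa [hmA, mul_one]

omit hcomm in
theorem centralizer_inf_eq_bot : centralizer (A : Set G) ⊓ M = ⊥ := by
  refine eq_bot_of_normal_of_le hcore ?_ inf_le_right
  refine normal_of_le_normalizer_of_sup_eq_top (sup_eq_top_of_normal hM hcore hA hne)
    (le_normalizer_of_commute fun a ha x hx ↦ mem_centralizer_iff.mp hx.1 a ha) ?_
  exact le_normalizer_iff.mpr fun m hm x hx ↦
    ⟨(inferInstance : (centralizer (A : Set G)).Normal).conj_mem x hx.1 m,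
      M.mul_mem (M.mul_mem hm hx.2) (M.inv_mem hm)⟩

/-- A nontrivial normal subgroup of the point stabilizer acts fixed point freely on the
abelian normal subgroup. -/
theorem inf_centralizer_eq_bot (hRne : R ≠ ⊥) (hRM : R ≤ M)
    (hR : M ≤ normalizer (R : Set G)) : A ⊓ centralizer (R : Set G) = ⊥ := by
  by_contra hb
  have hn : (A ⊓ centralizer (R : Set G)).Normal := by
    refine normal_of_le_normalizer_of_sup_eq_top (sup_eq_top_of_normal hM hcore hA hne)
      (le_normalizer_of_commute fun a ha x hx ↦ hcomm a ha x hx.1) ?_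
    refine le_normalizer_iff.mpr fun m hm x hx ↦ ⟨hA.conj_mem x hx.1 m, ?_⟩
    refine mem_centralizer_iff.mpr fun r hr ↦ ?_
    have h := mem_centralizer_iff.mp hx.2 (m⁻¹ * r * m)
      (by simpa using le_normalizer_iff.mp hR m⁻¹ (M.inv_mem hm) r hr)
    calc r * (m * x * m⁻¹) = m * (m⁻¹ * r * m * x) * m⁻¹ := by group
      _ = m * x * m⁻¹ * r := by rw [h]; group
  have h := eq_of_normal_of_le_of_ne_bot hM hcore hA hne hcomm hn inf_le_left hb
  refine hRne (le_bot_iff.mp ?_)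
  rw [← centralizer_inf_eq_bot hM hcore hA hne]
  exact le_inf (le_centralizer_iff.mp (inf_eq_left.mp h)) hRM

/-- Write a normalizing element as `am`. Then `[a, r]` lies in `A ∩ M = 1` for all `r ∈ R`, so `a ∈
C_A(R) = 1`. -/
theorem normalizer_le_of_le (hRne : R ≠ ⊥) (hR : M ≤ normalizer (R : Set G)) (hRX : R ≤ X)
    (hXM : X ≤ M) : normalizer (X : Set G) ≤ M := by
  intro g hg
  have h : g ∈ A ⊔ M := sup_eq_top_of_normal hM hcore hA hne ▸ mem_top g
  obtain ⟨a, ha, m, hm, rfl⟩ := mem_sup_of_normal_left.mp h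
  have hac : a ∈ A ⊓ centralizer (R : Set G) := by
    refine ⟨ha, mem_centralizer_iff.mpr fun r hr ↦ ?_⟩
    have hx : m⁻¹ * r * m ∈ X := hRX <| by
      simpa using le_normalizer_iff.mp hR m⁻¹ (M.inv_mem hm) r hr
    -- This is the conjugate of `m⁻¹ * r * m` by `a * m`.
    have hc : a * r * a⁻¹ ∈ M := hXM <| by
      have := (mem_normalizer_iff.mp hg _).mp hx
      convert this using 1
      group
    have hAM : a * (r * a⁻¹ * r⁻¹) ∈ A ⊓ M :=
      ⟨A.mul_mem ha (hA.conj_mem _ (A.inv_mem ha) r), by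
        simpa [mul_assoc] using M.mul_mem hc (M.inv_mem (hXM (hRX hr)))⟩
    rw [inf_eq_bot_of_abelian_normal hM hcore hA hne hcomm, mem_bot] at hAM
    calc r * a = (a * (r * a⁻¹ * r⁻¹))⁻¹ * a * r := by group
      _ = a * r := by rw [hAM]; group
  rw [inf_centralizer_eq_bot hM hcore hA hne hcomm hRne (hRX.trans hXM) hR, mem_bot] at hac
  rwa [hac, one_mul]

theorem index_eq_card_of_abelian_normal [Finite G] : M.index = Nat.card A := by
  rw [index_eq_relIndex_of_sup_eq_top (R := A)
    (by rw [sup_comm]; exact sup_eq_top_of_normal hM hcore hA hne), ← inf_relIndex_right,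
    inf_comm, inf_eq_bot_of_abelian_normal hM hcore hA hne hcomm, relIndex_bot_left]

/-- The point stabilizer has no nontrivial normal `q`-subgroup for the prime `q` dividing the
order of the abelian normal subgroup. -/
theorem not_dvd_index_of_isPGroup [Finite G] {q : ℕ} [Fact q.Prime] (hRne : R ≠ ⊥)
    (hRM : R ≤ M) (hR : M ≤ normalizer (R : Set G)) (hq : IsPGroup q R) : ¬ q ∣ M.index := by
  rw [index_eq_card_of_abelian_normal hM hcore hA hne hcomm]
  intro hdvd
  let φ : R →* MulAut A := MulAut.conjNormal.comp R.subtype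
  let _ : MulAction R A := MulAction.compHom A φ
  have hsmul (r : R) (a : A) : ((r • a : A) : G) = r * a * (r : G)⁻¹ := rfl
  -- The number of fixed points is divisible by `q`, so `1` is not the only one.
  obtain ⟨b, hb, hb1⟩ := hq.exists_fixed_point_of_prime_dvd_card_of_fixed_point A hdvd
    (a := 1) (fun r ↦ Subtype.ext (by simp [hsmul]))
  have hbc : (b : G) ∈ A ⊓ centralizer (R : Set G) := by
    refine ⟨b.2, mem_centralizer_iff.mpr fun r hr ↦ ?_⟩
    have := congrArg Subtype.val (hb ⟨r, hr⟩)
    rw [hsmul] at this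
    exact mul_inv_eq_iff_eq_mul.mp this
  rw [inf_centralizer_eq_bot hM hcore hA hne hcomm hRne hRM hR, mem_bot] at hbc
  exact hb1 (Subtype.ext hbc.symm)

end Primitive

/-! ### Subgroups, quotients and Hall subgroups of `π`-solvable groups. -/

section PiSolvable

open Subgroup

variable {G : Type*} [Group G] {π : Set Nat.Primes}

theorem IsPiSolvable.subgroup [Finite G] (hG : IsPiSolvable π G) (M : Subgroup G) :
    IsPiSolvable π M := by
  obtain ⟨n, H, hn, h0, htop, h⟩ := hG
  refine ⟨n, fun i ↦ (H i).subgroupOf M, fun i ↦ inferInstance, ?_, ?_, fun i hi ↦ ?_⟩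
  · simp [h0]
  · simp [htop]
  obtain ⟨hle, hfac⟩ := h i hi
  refine ⟨fun x hx ↦ hle hx, ?_⟩
  let φ : (H (i + 1)).subgroupOf M →* H (i + 1) := M.subtype.subgroupComap (H (i + 1))
  let ψ : ((H (i + 1)).subgroupOf M) ⧸
      ((H i).subgroupOf M).subgroupOf ((H (i + 1)).subgroupOf M) →*
      H (i + 1) ⧸ (H i).subgroupOf (H (i + 1)) :=
    QuotientGroup.map _ _ φ fun x hx ↦ hx
  have hψ : Function.Injective ψ := by
    rw [injective_iff_map_eq_one]
    intro x hx
    obtain ⟨x, rfl⟩ := QuotientGroup.mk_surjective x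
    rw [QuotientGroup.eq_one_iff]
    exact (QuotientGroup.eq_one_iff (φ x)).mp hx
  have hdvd := card_dvd_of_injective ψ hψ
  refine hfac.imp (fun hp ↦ hp.of_dvd hdvd) fun ⟨hp, hs⟩ ↦ ⟨hp.of_dvd hdvd, ?_⟩
  exact Group.isSolvable_of_isSolvable_injective hψ

/-- A nontrivial quotient of a `π`-solvable group has a nontrivial normal subgroup which is a
`π'`-group or a solvable `π`-group. -/
theorem IsPiSolvable.exists_normal_quotient [Finite G] (hG : IsPiSolvable π G) (D : Subgroup G)
    [D.Normal] (hD : D ≠ ⊤) :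
    ∃ L : Subgroup (G ⧸ D), L.Normal ∧ L ≠ ⊥ ∧
      (IsPiNumber πᶜ (Nat.card L) ∨ (IsPiNumber π (Nat.card L) ∧ Group.IsSolvable L)) := by
  classical
  obtain ⟨n, H, hn, h0, htop, h⟩ := hG
  -- The first term of the series not inside `D` has as image in `G ⧸ D` a quotient of a single
  -- factor.
  have hex : ∃ i, ¬ H i ≤ D := ⟨n, by rwa [htop, top_le_iff]⟩
  obtain ⟨i, hi⟩ : ∃ i, Nat.find hex = i + 1 := by
    refine Nat.exists_eq_succ_of_ne_zero fun h' ↦ ?_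
    have := Nat.find_spec hex
    rw [h', h0] at this
    exact this bot_le
  have hspec : ¬ H (i + 1) ≤ D := hi ▸ Nat.find_spec hex
  have hiD : H i ≤ D := not_not.mp (Nat.find_min hex (by omega))
  have hin : i < n := by
    have : Nat.find hex ≤ n := Nat.find_min' hex (by rwa [htop, top_le_iff])
    omega
  obtain ⟨hle, hfac⟩ := h i hin
  refine ⟨(H (i + 1)).map (QuotientGroup.mk' D),
    (hn _).map _ (QuotientGroup.mk'_surjective D), ?_, ?_⟩
  · rwa [Ne, Subgroup.map_eq_bot_iff, QuotientGroup.ker_mk']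
  let φ : H (i + 1) →* (H (i + 1)).map (QuotientGroup.mk' D) :=
    (QuotientGroup.mk' D).subgroupMap (H (i + 1))
  have hφ : Function.Surjective φ := (QuotientGroup.mk' D).subgroupMap_surjective (H (i + 1))
  let ψ : H (i + 1) ⧸ (H i).subgroupOf (H (i + 1)) →* (H (i + 1)).map (QuotientGroup.mk' D) :=
    QuotientGroup.lift _ φ fun x hx ↦
      Subtype.ext ((QuotientGroup.eq_one_iff (x : G)).mpr (hiD hx))
  have hψ : Function.Surjective ψ := fun y ↦ by
    obtain ⟨x, rfl⟩ := hφ y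
    exact ⟨QuotientGroup.mk x, rfl⟩
  have hdvd := card_dvd_of_surjective ψ hψ
  refine hfac.imp (fun hp ↦ hp.of_dvd hdvd) fun ⟨hp, hs⟩ ↦ ⟨hp.of_dvd hdvd, ?_⟩
  exact Group.isSolvable_of_surjective hψ

/-- The Schur-Zassenhaus theorem in the quotient by `N`, stated in the group itself. -/
theorem exists_index_eq_of_coprime {N U : Subgroup G} (hN : N.Normal) (hU : U.Normal)
    (hNU : N ≤ U) (hco : (N.relIndex U).Coprime U.index) :
    ∃ T : Subgroup G, N ≤ T ∧ N.relIndex T = U.index ∧ T.index = N.relIndex U := by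
  have hsurj := QuotientGroup.mk'_surjective N
  have hker := QuotientGroup.ker_mk' N
  have hcard : Nat.card (U.map (QuotientGroup.mk' N)) = N.relIndex U := by
    rw [← relIndex_ker, hker]
  have hidx : (U.map (QuotientGroup.mk' N)).index = U.index :=
    index_map_eq U hsurj (hker.trans_le hNU)
  have hUN : (U.map (QuotientGroup.mk' N)).Normal := hU.map _ hsurj
  obtain ⟨T, hT⟩ := exists_right_complement'_of_coprime
    (N := U.map (QuotientGroup.mk' N)) (by rwa [hcard, hidx])
  refine ⟨T.comap (QuotientGroup.mk' N), hker.ge.trans (ker_le_comap _ T), ?_, ?_⟩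
  · rw [← hidx, hT.symm.index_eq_card, ← map_comap_eq_self_of_surjective hsurj T,
      ← relIndex_ker, hker, map_comap_eq_self_of_surjective hsurj T]
  · rw [index_comap_of_surjective _ hsurj, hT.index_eq_card, hcard]

/-- If `N ≤ U` are normal subgroups of `G`, `U ≤ K`, and the indices `|K : U|` and `|U : N|` are
coprime, then `U / N` has a complement in `K / N`. -/
theorem exists_relIndex_eq_of_coprime {N U K : Subgroup G} (hN : N.Normal) (hU : U.Normal)
    (hNU : N ≤ U) (hUK : U ≤ K) (hco : (N.relIndex U).Coprime (U.relIndex K)) :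
    ∃ T : Subgroup G, N ≤ T ∧ T ≤ K ∧ N.relIndex T = U.relIndex K ∧
      T.relIndex K = N.relIndex U := by
  have hrel : (N.subgroupOf K).relIndex (U.subgroupOf K) = N.relIndex U :=
    relIndex_subgroupOf hUK
  obtain ⟨T, hT, h₁, h₂⟩ := exists_index_eq_of_coprime (N := N.subgroupOf K) (U := U.subgroupOf K)
    inferInstance inferInstance (comap_mono hNU) (by rwa [hrel])
  refine ⟨T.map K.subtype, fun x hx ↦ ⟨⟨x, hUK (hNU hx)⟩, hT hx, rfl⟩, map_subtype_le T, ?_, ?_⟩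
  · rw [← relIndex_comap]; exact h₁
  · rw [← hrel, ← h₂, relIndex, subgroupOf, comap_map_eq_self_of_injective K.subtype_injective]

/-- A `π`-solvable group has a Hall `π'`-subgroup. -/
theorem IsPiSolvable.exists_isHallSubgroup_compl [Finite G] (hG : IsPiSolvable π G) :
    ∃ K : Subgroup G, IsHallSubgroup πᶜ K := by
  obtain ⟨n, H, hn, h0, htop, h⟩ := hG
  -- Descend the series from `G`: `K / H (n - j)` is a Hall `π'`-subgroup of `G / H (n - j)`. A
  -- `π'`-factor leaves `K` unchanged; a `π`-factor is split off by Schur-Zassenhaus.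
  have key : ∀ j ≤ n, ∃ K : Subgroup G, H (n - j) ≤ K ∧ IsPiNumber π K.index ∧
      IsPiNumber πᶜ ((H (n - j)).relIndex K) := by
    intro j
    induction j with
    | zero =>
      intro _
      refine ⟨⊤, le_top, ?_, ?_⟩
      · rw [index_top]; exact isPiNumber_one
      · rw [Nat.sub_zero, htop, relIndex_self]; exact isPiNumber_one
    | succ j ih =>
      intro hj
      obtain ⟨K, hK, hidx, hrel⟩ := ih (by omega)
      obtain ⟨i, hi⟩ : ∃ i, n - j = i + 1 := ⟨n - j - 1, by omega⟩
      rw [show n - (j + 1) = i by omega]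
      rw [hi] at hK hrel
      obtain ⟨hle, hfac⟩ := h i (by omega)
      rcases hfac with hp | ⟨hp, -⟩
      · refine ⟨K, hle.trans hK, hidx, ?_⟩
        rw [← relIndex_mul_relIndex _ _ _ hle hK]
        exact IsPiNumber.mul hp hrel
      · obtain ⟨T, hT, hTK, h₁, h₂⟩ := exists_relIndex_eq_of_coprime (hn _) (hn _) hle hK
          (IsPiNumber.coprime hp hrel)
        refine ⟨T, hT, ?_, h₁ ▸ hrel⟩
        rw [← relIndex_mul_index hTK, h₂]
        exact IsPiNumber.mul hp hidx
  obtain ⟨K, -, hidx, hrel⟩ := key n le_rfl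
  rw [Nat.sub_self, h0, relIndex_bot_left] at hrel
  exact ⟨K, hrel, by rwa [compl_compl]⟩

end PiSolvable

/-! ### Prime divisors of the order of the Fitting subgroup. -/

section Fitting

open Subgroup

variable {G : Type*} [Group G]

theorem le_fittingSubgroup {N : Subgroup G} (hN : N.Normal) (hnil : Group.IsNilpotent N) :
    N ≤ fittingSubgroup G :=
  le_sSup ⟨hN, hnil⟩

/-- Induction on `S`, since `|NX|` divides `|N| |X|`. -/
theorem not_dvd_card_sSup_of_normal [Finite G] {q : ℕ} (hq : q.Prime) (S : Set (Subgroup G))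
    (hn : ∀ N ∈ S, N.Normal) (hS : ∀ N ∈ S, ¬ q ∣ Nat.card N) :
    ¬ q ∣ Nat.card (sSup S : Subgroup G) := by
  have hfin : S.Finite := Set.toFinite S
  induction S, hfin using Set.Finite.induction_on with
  | empty => simpa using hq.one_lt.ne'
  | @insert N S _ _ ih =>
    have hN : N.Normal := hn N (Set.mem_insert N S)
    rw [sSup_insert]
    intro hd
    rw [← relIndex_bot_left, ← relIndex_mul_relIndex ⊥ N (N ⊔ sSup S) bot_le le_sup_left,
      relIndex_bot_left, sup_comm, relIndex_sup_right] at hd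
    rcases hq.dvd_mul.mp hd with h | h
    · exact hS N (Set.mem_insert N S) h
    · exact ih (fun X hX ↦ hn X (Set.mem_insert_of_mem N hX))
        (fun X hX ↦ hS X (Set.mem_insert_of_mem N hX)) (h.trans (relIndex_dvd_card _ _))

theorem exists_normal_isPGroup_of_dvd_card_fittingSubgroup [Finite G] {q : ℕ} [Fact q.Prime]
    (h : q ∣ Nat.card (fittingSubgroup G)) :
    ∃ R : Subgroup G, R.Normal ∧ R ≠ ⊥ ∧ IsPGroup q R := by
  by_contra! hR
  refine not_dvd_card_sSup_of_normal (Fact.out : q.Prime)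
    {N : Subgroup G | N.Normal ∧ Group.IsNilpotent N} (fun N hN ↦ hN.1) ?_ h
  rintro N ⟨hN, hnil⟩ hd
  obtain ⟨Q⟩ : Nonempty (Sylow q N) := inferInstance
  -- Sylow subgroups of a nilpotent group are normal, hence characteristic, so `Q` is normal in `G`.
  have hQ : (Q : Subgroup N).Characteristic := Q.characteristic_of_normal inferInstance
  refine hR ((Q : Subgroup N).map N.subtype) inferInstance ?_ (Q.isPGroup'.map _)
  rw [Ne, map_eq_bot_iff_of_injective _ N.subtype_injective]
  exact Q.ne_bot_of_dvd_card hd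

end Fitting

/-! ### Transfer between `G` and its quotient by the core of `M`. -/

open Subgroup in
theorem theorem3 {G : Type*} [Group G] [Finite G] (π : Set Nat.Primes)
    (hG : IsPiSolvable π G)
    (hHall : ∃ H : Subgroup G, IsHallSubgroup π H ∧ Group.IsNilpotent H)
    (M : Subgroup G) (hM : IsCoatom M) (hMn : ¬ M.Normal)
    (hidx : IsPiNumber π M.index) :
    (fittingSubgroup (M ⧸ M.normalCore.subgroupOf M) ≠ ⊥ →
      ∀ q : ℕ, q.Prime → q ∣ Nat.card (fittingSubgroup (M ⧸ M.normalCore.subgroupOf M)) →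
        ∃ Q : Sylow q G, Subgroup.normalizer (Q : Set G) ≤ M) ∧
    (fittingSubgroup (M ⧸ M.normalCore.subgroupOf M) = ⊥ →
      ∃ K : Subgroup G, IsHallSubgroup πᶜ K ∧ Subgroup.normalizer (K : Set G) ≤ M) := by
  have hDtop : M.normalCore.subgroupOf M ≠ ⊤ := by
    rw [Ne, subgroupOf_eq_top]
    exact fun h ↦ hMn (le_antisymm M.normalCore_le h ▸ M.normalCore_normal)
  have hker : (QuotientGroup.mk' M.normalCore).ker ≤ M := by
    rw [QuotientGroup.ker_mk']; exact M.normalCore_le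
  have hsurj := QuotientGroup.mk'_surjective M.normalCore
  have hcomap : (M.map (QuotientGroup.mk' M.normalCore)).comap (QuotientGroup.mk' M.normalCore)
      = M := comap_map_eq_self hker
  have hidx' : (M.map (QuotientGroup.mk' M.normalCore)).index = M.index :=
    index_map_eq M hsurj hker
  have hMbar : IsCoatom (M.map (QuotientGroup.mk' M.normalCore)) := by
    refine ⟨fun h ↦ hM.1 (by rw [← hcomap, h, comap_top]), fun X hX ↦ ?_⟩
    have hlt := (comap_lt_comap_of_surjective hsurj).mpr hX
    rw [hcomap] at hlt
    rw [← map_comap_eq_self_of_surjective hsurj X, hM.2 _ hlt, map_top_of_surjective _ hsurj]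
  have hcore : (M.map (QuotientGroup.mk' M.normalCore)).normalCore = ⊥ := by
    have hle : ((M.map (QuotientGroup.mk' M.normalCore)).normalCore).comap
        (QuotientGroup.mk' M.normalCore) ≤ M.normalCore :=
      normal_le_normalCore.mpr ((comap_mono (normalCore_le _)).trans hcomap.le)
    rw [← map_comap_eq_self_of_surjective hsurj (normalCore _), Subgroup.map_eq_bot_iff,
      QuotientGroup.ker_mk']
    exact hle
  obtain ⟨A, hA, hAne, hcomm⟩ : ∃ A : Subgroup (G ⧸ M.normalCore), A.Normal ∧ A ≠ ⊥ ∧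
      ∀ a ∈ A, ∀ b ∈ A, a * b = b * a := by
    obtain ⟨L, hL, hLne, hLp⟩ := hG.exists_normal_quotient M.normalCore
      fun h ↦ hM.1 (top_le_iff.mp (h ▸ M.normalCore_le))
    have hs : Group.IsSolvable L := by
      -- If `L` were a `π'`-group, `|G : M|` would divide `|L|` and so be both a `π`- and a
      -- `π'`-number.
      refine hLp.elim (fun hp ↦ (hM.1 ?_).elim) fun hp ↦ hp.2
      rw [← index_eq_one]
      refine hidx.eq_one (hp.of_dvd ?_)
      rw [← hidx', index_eq_relIndex_of_sup_eq_top (R := L)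
        (by rw [sup_comm]; exact sup_eq_top_of_normal hMbar hcore hL hLne)]
      exact relIndex_dvd_card _ _
    obtain ⟨A, hA, hAne, -, hcomm⟩ := exists_abelian_normal_of_isSolvable L hL hLne hs
    exact ⟨A, hA, hAne, hcomm⟩
  let f : M ⧸ M.normalCore.subgroupOf M →* G ⧸ M.normalCore :=
    QuotientGroup.map _ _ M.subtype fun x hx ↦ hx
  have hf : Function.Injective f := by
    rw [injective_iff_map_eq_one]
    intro x hx
    obtain ⟨x, rfl⟩ := QuotientGroup.mk_surjective x
    rw [QuotientGroup.eq_one_iff]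
    exact (QuotientGroup.eq_one_iff (x : G)).mp hx
  have hfmap (X : Subgroup M) :
      (X.map (QuotientGroup.mk' (M.normalCore.subgroupOf M))).map f =
        (X.map M.subtype).map (QuotientGroup.mk' M.normalCore) := by
    rw [map_map, map_map]; rfl
  have htop : (⊤ : Subgroup (M ⧸ M.normalCore.subgroupOf M)).map f =
      M.map (QuotientGroup.mk' M.normalCore) := by
    rw [← map_top_of_surjective _ (QuotientGroup.mk'_surjective (M.normalCore.subgroupOf M)),
      hfmap, ← MonoidHom.range_eq_map, range_subtype]
  have hRM (R : Subgroup (M ⧸ M.normalCore.subgroupOf M)) :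
      R.map f ≤ M.map (QuotientGroup.mk' M.normalCore) := htop ▸ map_mono le_top
  have hRn (R : Subgroup (M ⧸ M.normalCore.subgroupOf M)) (hR : R.Normal) :
      M.map (QuotientGroup.mk' M.normalCore) ≤ normalizer (R.map f : Set (G ⧸ M.normalCore)) := by
    rw [← htop, ← normalizer_eq_top_iff.mpr hR]
    exact le_normalizer_map f
  have hRne (R : Subgroup (M ⧸ M.normalCore.subgroupOf M)) (hR : R ≠ ⊥) : R.map f ≠ ⊥ := by
    rwa [Ne, map_eq_bot_iff_of_injective _ hf]
  have key (R : Subgroup (M ⧸ M.normalCore.subgroupOf M)) (hR : R.Normal) (hR₁ : R ≠ ⊥)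
      (K : Subgroup M) (hco : (Nat.card R).Coprime K.index) :
      normalizer (K.map M.subtype : Set G) ≤ M := by
    -- Coprimality puts the normal subgroup `R` inside the image of `K`.
    have hRK : R ≤ K.map (QuotientGroup.mk' (M.normalCore.subgroupOf M)) :=
      le_of_coprime_card_index (hco.coprime_dvd_right
        (index_map_dvd K (QuotientGroup.mk'_surjective (M.normalCore.subgroupOf M))))
    have hN := normalizer_le_of_le hMbar hcore hA hAne hcomm (hRne R hR₁) (hRn R hR)
      (hfmap K ▸ map_mono hRK) (map_mono (map_subtype_le K))
    exact (map_le_iff_le_comap.mp ((le_normalizer_map _).trans hN)).trans hcomap.le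
  refine ⟨fun _ q hq hdvd ↦ ?_, fun hF ↦ ?_⟩
  · have : Fact q.Prime := ⟨hq⟩
    obtain ⟨R, hR, hR₁, hRq⟩ := exists_normal_isPGroup_of_dvd_card_fittingSubgroup hdvd
    have hqM : ¬ q ∣ M.index := hidx' ▸ not_dvd_index_of_isPGroup hMbar hcore hA hAne hcomm
      (hRne R hR₁) (hRM R) (hRn R hR) (hRq.map f)
    obtain ⟨Q⟩ : Nonempty (Sylow q M) := inferInstance
    have hQ : ¬ q ∣ ((Q : Subgroup M).map M.subtype).index := by
      rw [index_map_subtype]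
      exact hq.not_dvd_mul Q.not_dvd_index hqM
    refine ⟨(Q.isPGroup'.map M.subtype).toSylow hQ, key R hR hR₁ Q ?_⟩
    obtain ⟨n, hn⟩ := IsPGroup.iff_card.mp hRq
    rw [hn]
    exact Nat.Coprime.pow_left n ((Nat.Prime.coprime_iff_not_dvd hq).mpr Q.not_dvd_index)
  · obtain ⟨R, hR, hR₁, hRp⟩ : ∃ R : Subgroup (M ⧸ M.normalCore.subgroupOf M),
        R.Normal ∧ R ≠ ⊥ ∧ IsPiNumber πᶜ (Nat.card R) := by
      obtain ⟨L, hL, hLne, hLp⟩ := (hG.subgroup M).exists_normal_quotient _ hDtop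
      -- A solvable `L` would contain a nontrivial abelian normal subgroup, which lies in the
      -- Fitting subgroup.
      refine ⟨L, hL, hLne, hLp.resolve_right fun hs ↦ ?_⟩
      obtain ⟨B, hB, hBne, -, hBc⟩ := exists_abelian_normal_of_isSolvable L hL hLne hs.2
      let _ : CommGroup B :=
        { (inferInstance : Group B) with mul_comm := fun a b ↦ Subtype.ext (hBc a a.2 b b.2) }
      exact hBne (le_bot_iff.mp (hF ▸ le_fittingSubgroup hB CommGroup.isNilpotent))
    obtain ⟨K, hK, hKi⟩ := (hG.subgroup M).exists_isHallSubgroup_compl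
    refine ⟨K.map M.subtype, ⟨?_, ?_⟩, key R hR hR₁ K (hRp.coprime hKi)⟩
    · rwa [card_map_of_injective M.subtype_injective]
    · rw [index_map_subtype]
      exact hKi.mul (by rwa [compl_compl])
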